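/- Let $N$ be a (Hausdorff, finite-dimensional) complex manifold with holomorphic tangent bundle $TN$. A complex Finsler metric on $N$ is a continuous function $G\colon TN\to\mathbb R$ that is smooth away from the zero section, satisfies $G(z,v)\ge 0$ with equality if and only if $v=0$, and satisfies $G(z,\lambda v)=|\lambda|^2G(z,v)$ for all $\lambda\in\mathbb C$. For a nonzero tangent vector $(z,v)$, the holomorphic sectional curvature of $G$ is $$K_G(z,[v])=\sup_\varphi K_{\varphi^*G}(0),\qquad K_{\varphi^*G}=-\frac{2}{\varphi^*G}\,\frac{\partial^2\log\varphi^*G}{\partial w\,\partial\bar w},\qquad (\varphi^*G)(w)=G(\varphi(w),\varphi'(w)),$$ where the supremum (possibly $+\infty$) runs over all holomorphic maps $\varphi\colon\{|w|<1\}\to N$ with $\varphi(0)=z$ and $\varphi'(0)=\lambda v$ for some $\lambda\in\mathbb C\setminus\{0\}$. The Kobayashi metric is $$k_N(z,v)=\inf\Big\{\tfrac1r : r>0,\ \text{there is a holomorphic } f\colon\{|w|<r\}\to N \text{ with } f(0)=z,\ f'(0)=v\Big\};$$ on a real tangent vector $V=X+\bar X$ with $X$ of type $(1,0)$ one puts $k_N(V)=2k_N(X)$.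 The Kobayashi pseudo-distance is $d_N(p,q)=\inf_c\int_0^1k_N(c(t),c'(t))\,dt$, the infimum over all $C^1$ curves $c\colon[0,1]\to N$ from $p$ to $q$ (and $+\infty$ if there is none). $N$ is Kobayashi hyperbolic if $d_N$ is a distance in the strict sense: $d_N(p,q)=0$ if and only if $p=q$, $d_N$ is symmetric, satisfies the triangle inequality, and is finite on each connected component of $N$. Let $G_1$ be a complex Finsler metric on $N$ and let $K_2<0$ be a constant such that $K_{G_1}(z,[v])\le K_2$ for all $z\in N$ and all nonzero tangent vectors $v$ at $z$. Then $$4\,k_N(z,v)^2\ \ge\ -K_2\,G_1(z,v)\qquad\text{for all }(z,v)\in TN.$$ In particular, $N$ is Kobayashi hyperbolic. -/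

import Mathlib

open scoped Manifold ContDiff

noncomputable section

namespace ComplexFinsler

/-! Throughout, `N` is a complex manifold: a space with charts in a finite-dimensional complex
vector space `E` and holomorphic changes of charts.  `TangentBundle 𝓘(ℂ, E) N` is its holomorphic
tangent bundle: the vector `v : E` in the fibre over `z` is `∑ vⁱ ∂/∂zⁱ` in the coordinates
given by the chart at `z`. -/

variable {E : Type*} [NormedAddCommGroup E] [NormedSpace ℂ E]
variable {N : Type*} [TopologicalSpace N] [ChartedSpace E N]

/-- Complex Finsler metrics on `N`.  Smoothness away from the zero section is smoothness of a
function of real variables, so the tangent bundle is read through its charts with the real model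
`𝓘(ℝ, E).tangent` on `E × E`. -/
structure IsFinslerMetric [IsManifold 𝓘(ℂ, E) ω N] (G : TangentBundle 𝓘(ℂ, E) N → ℝ) :
    Prop where
  continuous : Continuous G
  smooth : ContMDiffOn 𝓘(ℝ, E).tangent 𝓘(ℝ, ℝ) ∞ G {x | x.snd ≠ 0}
  nonneg : ∀ x, 0 ≤ G x
  eq_zero_iff : ∀ x, G x = 0 ↔ x.snd = 0
  smul : ∀ (x : TangentBundle 𝓘(ℂ, E) N) (c : ℂ), G ⟨x.proj, c • x.snd⟩ = ‖c‖ ^ 2 * G x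

/-- The holomorphic tangent vector `φ_*(∂/∂w)` at `φ w`, that is `φ'(w)`, as a point of the
tangent bundle. -/
def velocity (φ : ℂ → N) (w : ℂ) : TangentBundle 𝓘(ℂ, E) N :=
  ⟨φ w, mfderiv 𝓘(ℂ, ℂ) 𝓘(ℂ, E) φ w (1 : ℂ)⟩

/-- The Gaussian curvature `-(2 / g) ∂²(log g)/∂w∂w̄` of the conformal metric `g dw ⊗ dw̄` at `w`;
here `∂²/∂w∂w̄` is a quarter of the Laplacian `∂²/∂x² + ∂²/∂y²`, where `w = x + i y`. -/
def gaussianCurvature (g : ℂ → ℝ) (w : ℂ) : ℝ :=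
  -(2 / g w) * (1 / 4 * Laplacian.laplacian (fun u : ℂ => Real.log (g u)) w)

/-- The holomorphic sectional curvature of `G` at (the line spanned by) a nonzero tangent vector
`x = (z, v)`: the supremum, possibly `+∞`, of the Gaussian curvatures at `0` of the pulled back
metrics `φ^* G`, over all holomorphic maps `φ` from the unit disc to `N` with `φ 0 = z` and
`φ' 0 = c v` for some nonzero complex number `c`. -/
def holomorphicSectionalCurvature (G : TangentBundle 𝓘(ℂ, E) N → ℝ)
    (x : TangentBundle 𝓘(ℂ, E) N) : EReal :=
  ⨆ (φ : ℂ → N) (_ : MDifferentiableOn 𝓘(ℂ, ℂ) 𝓘(ℂ, E) φ (Metric.ball 0 1))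
    (_ : ∃ c : ℂ, c ≠ 0 ∧ velocity φ 0 = (⟨x.proj, c • x.snd⟩ : TangentBundle 𝓘(ℂ, E) N)),
    ((gaussianCurvature (fun w => G (velocity φ w)) 0 : ℝ) : EReal)

/-- The Kobayashi metric: the infimum of all `1 / r` such that there is a holomorphic map `f` from
the disc of radius `r` to `N` with `f 0 = z` and `f' 0 = v`, where `x = (z, v)`. -/
def kobayashiMetric (x : TangentBundle 𝓘(ℂ, E) N) : ℝ :=
  sInf {s : ℝ | ∃ r : ℝ, 0 < r ∧ s = 1 / r ∧ ∃ f : ℂ → N,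
    MDifferentiableOn 𝓘(ℂ, ℂ) 𝓘(ℂ, E) f (Metric.ball 0 r) ∧ velocity f 0 = x}

/-- The velocity of a curve `c : [0, 1] → N`, a real tangent vector `V` written as `V = X + X̄`
with `X` of type `(1, 0)`: the value is `X`.  In coordinates `z`, `X` is `∑ (dzⁱ/dt) ∂/∂zⁱ`, so
it has the same coordinate vector in `E` as the real derivative of `c`. -/
def curveVelocity (c : ℝ → N) (t : ℝ) : TangentBundle 𝓘(ℂ, E) N :=
  ⟨c t, (mfderivWithin 𝓘(ℝ, ℝ) 𝓘(ℝ, E) c (Set.Icc 0 1) t (1 : ℝ) : E)⟩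

variable (E) in
/-- The length of a curve `c : [0, 1] → N` in the Kobayashi metric, which is `2 k(X)` on a real
tangent vector `V = X + X̄`. -/
def kobayashiLength (c : ℝ → N) : ENNReal :=
  ∫⁻ t in Set.Icc (0 : ℝ) 1,
    ENNReal.ofReal (2 * kobayashiMetric (curveVelocity c t : TangentBundle 𝓘(ℂ, E) N))

variable (E) in
/-- The Kobayashi pseudo-distance: the infimum of the lengths of the curves of class `C¹` from
`p` to `q`, and `+∞` if there is no such curve. -/
def kobayashiDist (p q : N) : ENNReal :=
  ⨅ (c : ℝ → N) (_ : ContMDiffOn 𝓘(ℝ, ℝ) 𝓘(ℝ, E) 1 c (Set.Icc 0 1)) (_ : c 0 = p) (_ : c 1 = q),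
    kobayashiLength E c

variable (E N) in
/-- `N` is Kobayashi hyperbolic: the Kobayashi pseudo-distance is a distance in the strict sense
(finite on each connected component of `N`). -/
structure IsKobayashiHyperbolic : Prop where
  eq_zero_iff : ∀ p q : N, kobayashiDist E p q = 0 ↔ p = q
  symm : ∀ p q : N, kobayashiDist E p q = kobayashiDist E q p
  triangle : ∀ p q r : N, kobayashiDist E p r ≤ kobayashiDist E p q + kobayashiDist E q r
  finite : ∀ p : N, ∀ q ∈ connectedComponent p, kobayashiDist E p q ≠ ⊤

end ComplexFinsler

end

/-!
The inequality is Ahlfors' form of the Schwarz lemma.  For a holomorphic disc `f` of radius `r` put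
`g w = G₁ (f w, f' w)`.  Precomposing `f` with affine maps turns the curvature hypothesis into
`Δ log g ≥ -2 K₂ g` wherever `g > 0`.  For `s < r` the function `g w * (s ^ 2 - |w| ^ 2) ^ 2`
vanishes on the circle of radius `s`, so it is zero or attains its maximum at an interior point
where `g > 0`.  There the Laplacian of `log g + 2 log (s ^ 2 - |w| ^ 2)` is nonpositive, which
bounds the maximum, hence the value at `0`; letting `s` tend to `r` gives `-K₂ g 0 ≤ 4 / r ^ 2`
(`ahlfors_schwarz`, `IsFinslerMetric.neg_mul_le_of_disc`).  Taking the infimum over discs gives the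
estimate of the Kobayashi metric `k`.

The length in the Kobayashi distance is that of the field of fibre norms `V ↦ 2 k(V)`, which is
absolutely homogeneous over `ℝ`, so symmetry and the triangle inequality are those of Mathlib's
`Manifold.riemannianEDist`, which needs no regularity of these norms.  In a chart, linear discs
bound `k` from above; hence the distance is finite near each point, and the points at finite
distance from a given one form a clopen set.  The lower bound for `k` and compactness of the unit
sphere bundle over a small closed ball give `2 k ≥ m |·|` in a chart at `p`, so a curve from `p` to
a point outside the ball has length at least `m` times the radius (`kobayashiDist_pos`).
-/

open Set Filter Topology

namespace ComplexFinsler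

noncomputable section

/-! ### Laplacians in the plane and the Ahlfors–Schwarz lemma -/

theorem iteratedFDeriv_two_eq_deriv_deriv {V : Type*} [NormedAddCommGroup V] [NormedSpace ℝ V]
    {h : V → ℝ} {x : V} (hh : ContDiffAt ℝ 2 h x) (e : V) :
    iteratedFDeriv ℝ 2 h x ![e, e] = deriv (deriv fun t : ℝ => h (x + t • e)) 0 := by
  have hline (t : ℝ) : HasDerivAt (fun t : ℝ => x + t • e) e t := by
    simpa using ((hasDerivAt_id t).smul_const e).const_add x
  have hcont : Tendsto (fun t : ℝ => x + t • e) (𝓝 0) (𝓝 x) := by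
    have := (hline 0).continuousAt.tendsto
    simpa using this
  have h1 : (deriv fun t : ℝ => h (x + t • e)) =ᶠ[𝓝 0] fun t => fderiv ℝ h (x + t • e) e := by
    have hd : ∀ᶠ y in 𝓝 x, DifferentiableAt ℝ h y := by
      filter_upwards [hh.eventually (by simp)] with y hy
      exact hy.differentiableAt (by norm_num)
    filter_upwards [hcont.eventually hd] with t ht
    exact (ht.hasFDerivAt.comp_hasDerivAt t (hline t)).deriv
  have h2 : HasFDerivAt (fderiv ℝ h) (fderiv ℝ (fderiv ℝ h) x) (x + (0 : ℝ) • e) := by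
    rw [zero_smul, add_zero]
    exact ((hh.fderiv_right (m := 1) (by norm_num)).differentiableAt (by norm_num)).hasFDerivAt
  have h3 : HasDerivAt (fun t : ℝ => fderiv ℝ h (x + t • e)) (fderiv ℝ (fderiv ℝ h) x e) 0 :=
    h2.comp_hasDerivAt (0 : ℝ) (hline 0)
  have h4 : HasDerivAt (fun t : ℝ => fderiv ℝ h (x + t • e) e)
      (fderiv ℝ (fderiv ℝ h) x e e) 0 :=
    ((ContinuousLinearMap.apply ℝ ℝ e).hasFDerivAt.comp_hasDerivAt (0 : ℝ) h3)
  rw [h1.deriv_eq, h4.deriv, iteratedFDeriv_two_apply]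
  rfl

/-- If the second derivative were positive, the point would also be a local minimum, so the
function would be locally constant. -/
theorem deriv_deriv_nonpos_of_isLocalMax {f : ℝ → ℝ} {a : ℝ} (hf : IsLocalMax f a)
    (hc : ContinuousAt f a) : deriv (deriv f) a ≤ 0 := by
  by_contra! hpos
  have hmin := isLocalMin_of_deriv_deriv_pos hpos hf.deriv_eq_zero hc
  have hconst : f =ᶠ[𝓝 a] fun _ => f a := by
    filter_upwards [hf, hmin] with t h1 h2 using le_antisymm h1 h2
  have h0 : deriv (deriv f) a = 0 := by
    have : deriv f =ᶠ[𝓝 a] fun _ => 0 := by simpa using hconst.deriv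
    simpa using this.deriv_eq
  exact hpos.ne' h0

theorem laplacian_nonpos_of_isLocalMax {h : ℂ → ℝ} {w : ℂ} (hh : ContDiffAt ℝ 2 h w)
    (hmax : IsLocalMax h w) : Laplacian.laplacian h w ≤ 0 := by
  have key (e : ℂ) : iteratedFDeriv ℝ 2 h w ![e, e] ≤ 0 := by
    rw [iteratedFDeriv_two_eq_deriv_deriv hh]
    have hcl : ContinuousAt (fun t : ℝ => w + t • e) 0 := by fun_prop
    have hw : w + (0 : ℝ) • e = w := by simp
    refine deriv_deriv_nonpos_of_isLocalMax ?_ ?_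
    · have : Tendsto (fun t : ℝ => w + t • e) (𝓝 0) (𝓝 w) := by simpa [hw] using hcl.tendsto
      filter_upwards [this.eventually hmax] with t ht
      simpa using ht
    · exact ContinuousAt.comp (g := h) (by rw [hw]; exact hh.continuousAt) hcl
  rw [InnerProductSpace.laplacian_eq_iteratedFDeriv_complexPlane]
  exact add_nonpos (key 1) (key Complex.I)

theorem deriv_deriv_log_quadratic {D a b : ℝ} (hD : 0 < D) :
    deriv (deriv fun t : ℝ => Real.log (D - 2 * a * t - b * t ^ 2)) 0
      = -(2 * b / D) - 4 * a ^ 2 / D ^ 2 := by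
  have hq (t : ℝ) : HasDerivAt (fun t : ℝ => D - 2 * a * t - b * t ^ 2) (-2 * a - 2 * b * t) t := by
    have := (((hasDerivAt_id t).const_mul (2 * a)).const_sub D).sub
      (((hasDerivAt_id t).pow 2).const_mul b)
    refine this.congr_deriv ?_
    simp; ring
  have hpos : ∀ᶠ t in 𝓝 (0 : ℝ), 0 < D - 2 * a * t - b * t ^ 2 :=
    (hq 0).continuousAt.eventually (lt_mem_nhds (by simpa using hD))
  have h1 : (deriv fun t : ℝ => Real.log (D - 2 * a * t - b * t ^ 2)) =ᶠ[𝓝 0]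
      fun t => (-2 * a - 2 * b * t) / (D - 2 * a * t - b * t ^ 2) := by
    filter_upwards [hpos] with t ht
    exact ((hq t).log ht.ne').deriv
  rw [h1.deriv_eq]
  have h2 : HasDerivAt (fun t : ℝ => -2 * a - 2 * b * t) (-(2 * b)) 0 := by
    simpa using ((hasDerivAt_id (0 : ℝ)).const_mul (2 * b)).const_sub (-2 * a)
  have h3 := (h2.div (hq 0) (by simpa using hD.ne')).deriv
  refine h3.trans ?_
  simp
  field_simp
  ring

theorem contDiffAt_log_sq_sub_norm_sq {s : ℝ} {w : ℂ} (hw : 0 < s ^ 2 - ‖w‖ ^ 2) :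
    ContDiffAt ℝ 2 (fun u : ℂ => Real.log (s ^ 2 - ‖u‖ ^ 2)) w :=
  (contDiffAt_const.sub (contDiff_norm_sq ℝ).contDiffAt).log hw.ne'

/-- Up to a constant, `-2 log (s ^ 2 - ‖u‖ ^ 2)` is the logarithm of the density of the Poincaré
metric of the disc of radius `s`. -/
theorem laplacian_log_sq_sub_norm_sq {s : ℝ} {w : ℂ} (hw : 0 < s ^ 2 - ‖w‖ ^ 2) :
    Laplacian.laplacian (fun u : ℂ => Real.log (s ^ 2 - ‖u‖ ^ 2)) w
      = -(4 * s ^ 2 / (s ^ 2 - ‖w‖ ^ 2) ^ 2) := by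
  rw [InnerProductSpace.laplacian_eq_iteratedFDeriv_complexPlane]
  simp only [iteratedFDeriv_two_eq_deriv_deriv (contDiffAt_log_sq_sub_norm_sq hw)]
  have h1 : (fun t : ℝ => Real.log (s ^ 2 - ‖w + t • (1 : ℂ)‖ ^ 2))
      = fun t => Real.log ((s ^ 2 - ‖w‖ ^ 2) - 2 * w.re * t - 1 * t ^ 2) := by
    funext t
    congr 1
    simp only [← Complex.normSq_eq_norm_sq, Complex.normSq_apply]
    simp
    ring
  have h2 : (fun t : ℝ => Real.log (s ^ 2 - ‖w + t • Complex.I‖ ^ 2))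
      = fun t => Real.log ((s ^ 2 - ‖w‖ ^ 2) - 2 * w.im * t - 1 * t ^ 2) := by
    funext t
    congr 1
    simp only [← Complex.normSq_eq_norm_sq, Complex.normSq_apply]
    simp
    ring
  rw [h1, h2, deriv_deriv_log_quadratic hw, deriv_deriv_log_quadratic hw]
  have h3 : ‖w‖ ^ 2 = w.re ^ 2 + w.im ^ 2 := by
    rw [← Complex.normSq_eq_norm_sq, Complex.normSq_apply]; ring
  field_simp
  rw [h3]
  ring

theorem laplacian_comp_affine (f : ℂ → ℝ) (a : ℂ) {ε : ℝ} (hε : ε ≠ 0) (u : ℂ) :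
    Laplacian.laplacian (fun u : ℂ => f (a + ε * u)) u
      = ε ^ 2 * Laplacian.laplacian f (a + ε * u) := by
  let L : ℂ ≃L[ℝ] ℂ := ContinuousLinearEquiv.smulLeft (Units.mk0 ε hε)
  have hL (z : ℂ) : L z = ε * z := by simp [L, Units.smul_def]
  have key (e : ℂ) : iteratedFDeriv ℝ 2 (fun u : ℂ => f (a + ε * u)) u ![e, e]
      = ε ^ 2 * iteratedFDeriv ℝ 2 f (a + ε * u) ![e, e] := by
    have h1 : (fun u : ℂ => f (a + ε * u)) = (fun z => f (a + z)) ∘ L := by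
      funext z; simp [hL]
    rw [h1, ← iteratedFDerivWithin_univ]
    have h2 := L.iteratedFDerivWithin_comp_right (fun z => f (a + z)) uniqueDiffOn_univ
      (x := u) (mem_univ _) 2
    rw [preimage_univ] at h2
    rw [h2, iteratedFDerivWithin_univ, iteratedFDeriv_comp_add_left, hL]
    rw [ContinuousMultilinearMap.compContinuousLinearMap_apply]
    have h3 : (fun i => (L : ℂ →L[ℝ] ℂ) (![e, e] i))
        = fun i => (fun _ : Fin 2 => ε) i • ![e, e] i := by
      funext i
      simp [hL]
    rw [h3, ContinuousMultilinearMap.map_smul_univ]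
    simp
  rw [InnerProductSpace.laplacian_eq_iteratedFDeriv_complexPlane,
    InnerProductSpace.laplacian_eq_iteratedFDeriv_complexPlane]
  simp only [key]
  ring

/-- The curvature is unchanged when a conformal metric is pulled back by `u ↦ a + ε u`. -/
theorem gaussianCurvature_comp_affine {g : ℂ → ℝ} {a : ℂ} (hg : ContDiffAt ℝ 2 g a)
    (ha : 0 < g a) {ε : ℝ} (hε : 0 < ε) {g' : ℂ → ℝ}
    (hg' : g' =ᶠ[𝓝 0] fun u => ε ^ 2 * g (a + ε * u)) :
    gaussianCurvature g' 0 = gaussianCurvature g a := by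
  have hcont : Tendsto (fun u : ℂ => a + ε * u) (𝓝 0) (𝓝 a) := by
    have : ContinuousAt (fun u : ℂ => a + ε * u) 0 := by fun_prop
    simpa using this.tendsto
  have hpos : ∀ᶠ u in 𝓝 a, 0 < g u := hg.continuousAt.eventually (lt_mem_nhds ha)
  have hlog : (fun u => Real.log (g' u)) =ᶠ[𝓝 0]
      (fun _ : ℂ => Real.log (ε ^ 2)) + fun u => Real.log (g (a + ε * u)) := by
    filter_upwards [hg', hcont.eventually hpos] with u h1 h2
    simp only [Pi.add_apply]
    rw [h1, Real.log_mul (by positivity) h2.ne']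
  have hsmooth : ContDiffAt ℝ 2 (fun u : ℂ => Real.log (g (a + ε * u))) 0 := by
    refine ContDiffAt.comp (g := fun u => Real.log (g u)) (0 : ℂ) ?_ ?_
    · simpa using hg.log ha.ne'
    · fun_prop
  unfold gaussianCurvature
  rw [(InnerProductSpace.laplacian_congr_nhds hlog).eq_of_nhds,
    contDiffAt_const.laplacian_add hsmooth, InnerProductSpace.laplacian_const,
    laplacian_comp_affine (fun u => Real.log (g u)) a hε.ne', hg'.eq_of_nhds]
  simp only [mul_zero, add_zero, Pi.zero_apply, zero_add]
  field_simp

/-- **Ahlfors–Schwarz lemma**, evaluated at the centre of the disc.  The metric `g` may have zeros;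
its curvature is bounded above only where `g` is positive. -/
theorem ahlfors_schwarz {g : ℂ → ℝ} {r K : ℝ} (hr : 0 < r) (hK : K < 0)
    (hg0 : ∀ w ∈ Metric.ball (0 : ℂ) r, 0 ≤ g w)
    (hgc : ContinuousOn g (Metric.ball 0 r))
    (hgs : ∀ w ∈ Metric.ball (0 : ℂ) r, g w ≠ 0 → ContDiffAt ℝ 2 g w)
    (hcurv : ∀ w ∈ Metric.ball (0 : ℂ) r, g w ≠ 0 → gaussianCurvature g w ≤ K) :
    -K * g 0 ≤ 4 * (1 / r) ^ 2 := by
  have key : ∀ s ∈ Ioo 0 r, -K * g 0 * s ^ 2 ≤ 4 := by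
    rintro s ⟨hs0, hsr⟩
    have hsub : Metric.closedBall (0 : ℂ) s ⊆ Metric.ball 0 r := Metric.closedBall_subset_ball hsr
    -- Compare `g` with the Poincaré metric of the smaller disc of radius `s`, which is infinite on
    -- the boundary circle, at the point where the quotient is largest.
    obtain ⟨w, hw, hmax⟩ := (isCompact_closedBall (0 : ℂ) s).exists_isMaxOn
      (f := fun u => g u * (s ^ 2 - ‖u‖ ^ 2) ^ 2) ⟨0, by simp [hs0.le]⟩
      ((hgc.mono hsub).mul (by fun_prop))
    have h0 : g 0 * s ^ 4 ≤ g w * (s ^ 2 - ‖w‖ ^ 2) ^ 2 := by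
      have := hmax (show (0 : ℂ) ∈ Metric.closedBall 0 s by simp [hs0.le])
      simp only [mem_ofPred_eq, norm_zero] at this
      calc g 0 * s ^ 4 = g 0 * (s ^ 2 - 0 ^ 2) ^ 2 := by ring
        _ ≤ _ := this
    have hwn : ‖w‖ ≤ s := by simpa using hw
    suffices h : -K * (g w * (s ^ 2 - ‖w‖ ^ 2) ^ 2) ≤ 4 * s ^ 2 by
      have h1 : (-K * g 0 * s ^ 2) * s ^ 2 ≤ 4 * s ^ 2 := by nlinarith
      exact le_of_mul_le_mul_right h1 (by positivity)
    by_cases hg : g w * (s ^ 2 - ‖w‖ ^ 2) ^ 2 = 0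
    · rw [hg]; simp; positivity
    have hgw : g w ≠ 0 := left_ne_zero_of_mul hg
    have hD : 0 < s ^ 2 - ‖w‖ ^ 2 := by
      have h1 : 0 ≤ s ^ 2 - ‖w‖ ^ 2 := by nlinarith [norm_nonneg w]
      exact lt_of_le_of_ne h1 fun h => hg (by rw [← h]; simp)
    have hws : w ∈ Metric.ball (0 : ℂ) s := by
      simpa using lt_of_pow_lt_pow_left₀ 2 hs0.le (by linarith)
    have hgpos : 0 < g w := lt_of_le_of_ne (hg0 w (hsub hw)) hgw.symm
    have hgd := hgs w (hsub hw) hgw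
    have hlogd : ContDiffAt ℝ 2 (fun u => Real.log (g u)) w := hgd.log hgw
    have hqd := contDiffAt_log_sq_sub_norm_sq hD
    have hlocal : IsLocalMax ((fun u => Real.log (g u)) +
        (2 : ℝ) • fun u : ℂ => Real.log (s ^ 2 - ‖u‖ ^ 2)) w := by
      have e1 : ∀ᶠ u in 𝓝 w, 0 < g u := hgd.continuousAt.eventually (lt_mem_nhds hgpos)
      have e2 : ∀ᶠ u : ℂ in 𝓝 w, 0 < s ^ 2 - ‖u‖ ^ 2 :=
        (show Continuous fun u : ℂ => s ^ 2 - ‖u‖ ^ 2 by fun_prop).continuousAt.eventually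
          (lt_mem_nhds hD)
      filter_upwards [e1, e2, Metric.isOpen_ball.mem_nhds hws] with u h1 h2 h3
      have h4 := hmax (Metric.ball_subset_closedBall h3)
      simp only [mem_ofPred_eq] at h4
      have h5 := Real.log_le_log (by positivity) h4
      rw [Real.log_mul h1.ne' (by positivity), Real.log_mul hgw (by positivity), Real.log_pow,
        Real.log_pow] at h5
      simpa using h5
    have hlap := laplacian_nonpos_of_isLocalMax (hlogd.add (hqd.const_smul (2 : ℝ))) hlocal
    have hsum := hlogd.laplacian_add (hqd.const_smul (2 : ℝ))
    have hsmul := InnerProductSpace.laplacian_smul (2 : ℝ) hqd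
    have hlog2 := laplacian_log_sq_sub_norm_sq hD
    change Laplacian.laplacian ((fun u => Real.log (g u)) +
        (2 : ℝ) • fun u : ℂ => Real.log (s ^ 2 - ‖u‖ ^ 2)) w ≤ 0 at hlap
    change Laplacian.laplacian ((fun u => Real.log (g u)) +
        (2 : ℝ) • fun u : ℂ => Real.log (s ^ 2 - ‖u‖ ^ 2)) w = _ + Laplacian.laplacian
        ((2 : ℝ) • fun u : ℂ => Real.log (s ^ 2 - ‖u‖ ^ 2)) w at hsum
    rw [hsum, hsmul, hlog2] at hlap
    have hc := hcurv w (hsub hw) hgw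
    unfold gaussianCurvature at hc
    set Λ := Laplacian.laplacian (fun u : ℂ => Real.log (g u)) w
    have h6 : -K * (2 * g w) ≤ Λ := by
      have : -(2 / g w) * (1 / 4 * Λ) * (2 * g w) = -Λ := by field_simp; ring
      nlinarith
    have h7 : Λ * (s ^ 2 - ‖w‖ ^ 2) ^ 2 ≤ 8 * s ^ 2 := by
      have : Λ ≤ 8 * s ^ 2 / (s ^ 2 - ‖w‖ ^ 2) ^ 2 := by
        have e : 8 * s ^ 2 / (s ^ 2 - ‖w‖ ^ 2) ^ 2 = 2 * (4 * s ^ 2 / (s ^ 2 - ‖w‖ ^ 2) ^ 2) := by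
          ring
        rw [e]; simp only [smul_eq_mul] at hlap; linarith
      rwa [le_div_iff₀ (by positivity)] at this
    nlinarith [mul_le_mul_of_nonneg_right h6 (sq_nonneg (s ^ 2 - ‖w‖ ^ 2))]
  have hlim : -K * g 0 * r ^ 2 ≤ 4 := by
    have hc : Tendsto (fun s : ℝ => -K * g 0 * s ^ 2) (𝓝[<] r) (𝓝 (-K * g 0 * r ^ 2)) :=
      (show Continuous fun s : ℝ => -K * g 0 * s ^ 2 by fun_prop).continuousWithinAt
    exact le_of_tendsto hc (by filter_upwards [Ioo_mem_nhdsLT hr] with s hs using key s hs)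
  rw [one_div, inv_pow, ← div_eq_mul_inv, le_div_iff₀ (by positivity)]
  exact hlim

/-! ### Holomorphic and real derivatives -/

section RestrictScalars

variable {E : Type*} [NormedAddCommGroup E] [NormedSpace ℂ E]
variable {F : Type*} [NormedAddCommGroup F] [NormedSpace ℂ F]
variable {N : Type*} [TopologicalSpace N] [ChartedSpace E N]
variable {M : Type*} [TopologicalSpace M] [ChartedSpace F M]

/-- A holomorphic map is differentiable for the underlying real structures, with the same
derivative. -/
theorem hasMFDerivAt_restrictScalars {f : N → M} {x : N} {f' : E →L[ℂ] F}
    (h : HasMFDerivAt 𝓘(ℂ, E) 𝓘(ℂ, F) f x f') :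
    HasMFDerivAt 𝓘(ℝ, E) 𝓘(ℝ, F) f x (f'.restrictScalars ℝ) :=
  ⟨h.1, h.2.restrictScalars ℝ⟩

theorem isManifold_restrictScalars [IsManifold 𝓘(ℂ, E) ω N] : IsManifold 𝓘(ℝ, E) ω N := by
  refine isManifold_of_contDiffOn 𝓘(ℝ, E) ω N fun e e' he he' => ?_
  have h := (contDiffGroupoid ω 𝓘(ℂ, E)).compatible he he'
  rw [contDiffGroupoid, mem_groupoid_of_pregroupoid] at h
  exact ContDiffOn.restrict_scalars ℝ h.1

end RestrictScalars

section

variable {E : Type*} [NormedAddCommGroup E] [NormedSpace ℂ E]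
variable {N : Type*} [TopologicalSpace N] [ChartedSpace E N]

/-- The chain rule for `u ↦ a + b * u`, stated in the tangent bundle. -/
theorem velocity_comp_affine {f : ℂ → N} {a b u : ℂ}
    (hf : MDifferentiableAt 𝓘(ℂ, ℂ) 𝓘(ℂ, E) f (a + b * u)) :
    (velocity (fun u => f (a + b * u)) u : TangentBundle 𝓘(ℂ, E) N)
      = ⟨f (a + b * u), b • (velocity f (a + b * u) : TangentBundle 𝓘(ℂ, E) N).snd⟩ := by
  have h1 : HasDerivAt (fun u : ℂ => a + b * u) b u := by
    simpa using ((hasDerivAt_id u).const_mul b).const_add a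
  have h2 : HasMFDerivAt 𝓘(ℂ, ℂ) 𝓘(ℂ, ℂ) (fun u : ℂ => a + b * u) u
    (ContinuousLinearMap.toSpanSingleton ℂ b) := h1.hasFDerivAt.hasMFDerivAt
  have h3 := (hf.hasMFDerivAt.comp u h2).mfderiv
  have h4 : mfderiv 𝓘(ℂ, ℂ) 𝓘(ℂ, E) (fun u => f (a + b * u)) u (1 : ℂ)
      = b • mfderiv 𝓘(ℂ, ℂ) 𝓘(ℂ, E) f (a + b * u) (1 : ℂ) := by
    refine (congrArg (fun L => L (1 : ℂ)) h3).trans ?_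
    have h5 : ContinuousLinearMap.toSpanSingleton ℂ b (1 : ℂ) = b • (1 : ℂ) := by simp
    refine (congrArg (mfderiv 𝓘(ℂ, ℂ) 𝓘(ℂ, E) f (a + b * u)) h5).trans ?_
    exact map_smul (mfderiv 𝓘(ℂ, ℂ) 𝓘(ℂ, E) f (a + b * u)) b (1 : ℂ)
  unfold velocity
  exact congrArg (Bundle.TotalSpace.mk (f (a + b * u))) h4

theorem mdifferentiableOn_comp_affine {f : ℂ → N} {U V : Set ℂ} {a b : ℂ}
    (hf : MDifferentiableOn 𝓘(ℂ, ℂ) 𝓘(ℂ, E) f U) (h : ∀ u ∈ V, a + b * u ∈ U) :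
    MDifferentiableOn 𝓘(ℂ, ℂ) 𝓘(ℂ, E) (fun u => f (a + b * u)) V :=
  hf.comp (g := f) (f := fun u => a + b * u)
    (Differentiable.mdifferentiable (by fun_prop)).mdifferentiableOn h

end

section

variable {E : Type*} [NormedAddCommGroup E] [NormedSpace ℂ E]
variable {N : Type*} [TopologicalSpace N] [ChartedSpace E N] [IsManifold 𝓘(ℂ, E) ω N]

/-- The vector in `E` representing a tangent vector in the chart at `p` (see
`fiberCoord_eq_mfderiv`), meaningful when the base point lies in the domain of that chart. -/
def fiberCoord (p : N) (x : TangentBundle 𝓘(ℂ, E) N) : E :=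
  (trivializationAt E (TangentSpace 𝓘(ℂ, E)) p x).2

theorem fiberCoord_eq_mfderiv {p : N} {x : TangentBundle 𝓘(ℂ, E) N}
    (hx : x.proj ∈ (chartAt E p).source) :
    fiberCoord p x = mfderiv 𝓘(ℂ, E) 𝓘(ℂ, E) (chartAt E p) x.proj x.snd := by
  have h := TangentBundle.continuousLinearMapAt_trivializationAt (I := 𝓘(ℂ, E)) hx
  have h2 : (extChartAt 𝓘(ℂ, E) p : N → E) = chartAt E p := by simp [mfld_simps]
  rw [h2] at h
  refine Eq.trans ?_ (congrArg (fun L => L x.snd) h)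
  rw [Bundle.Trivialization.continuousLinearMapAt_apply,
    Bundle.Trivialization.coe_linearMapAt_of_mem _ hx]
  rfl

theorem fiberCoord_smul {p : N} {x : TangentBundle 𝓘(ℂ, E) N}
    (hx : x.proj ∈ (chartAt E p).source) (c : ℂ) :
    fiberCoord p ⟨x.proj, c • x.snd⟩ = c • fiberCoord p x := by
  rw [fiberCoord_eq_mfderiv hx, fiberCoord_eq_mfderiv (by exact hx)]
  exact map_smul _ c x.snd

/-- Equality of points of the tangent bundle without transport between fibres whose base points
are only propositionally equal. -/
theorem eq_of_fiberCoord_eq {p : N} {x y : TangentBundle 𝓘(ℂ, E) N}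
    (hx : x.proj ∈ (chartAt E p).source) (hxy : x.proj = y.proj)
    (h : fiberCoord p x = fiberCoord p y) : x = y := by
  set e := trivializationAt E (TangentSpace 𝓘(ℂ, E)) p
  have hx' : x ∈ e.source := e.mem_source.2 hx
  have hy' : y ∈ e.source := e.mem_source.2 (hxy ▸ hx)
  refine e.injOn hx' hy' (Prod.ext ?_ h)
  exact (e.coe_fst hx').trans (hxy.trans (e.coe_fst hy').symm)

/-! ### Pulling back to holomorphic discs -/

theorem contDiffAt_chart_comp [CompleteSpace E] {φ : ℂ → N} {U : Set ℂ} (hU : IsOpen U)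
    (hφ : MDifferentiableOn 𝓘(ℂ, ℂ) 𝓘(ℂ, E) φ U) {w : ℂ} (hw : w ∈ U) {p : N}
    (hp : φ w ∈ (chartAt E p).source) {n : WithTop ℕ∞} : ContDiffAt ℂ n (chartAt E p ∘ φ) w := by
  have hV : IsOpen (U ∩ φ ⁻¹' (chartAt E p).source) :=
    hφ.continuousOn.isOpen_inter_preimage hU (chartAt E p).open_source
  have h1 : MDifferentiableOn 𝓘(ℂ, ℂ) 𝓘(ℂ, E) (chartAt E p ∘ φ)
      (U ∩ φ ⁻¹' (chartAt E p).source) :=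
    (mdifferentiableOn_atlas (chart_mem_atlas E p)).comp (hφ.mono inter_subset_left)
      inter_subset_right
  exact (h1.differentiableOn.analyticAt (hV.mem_nhds ⟨hw, hp⟩)).contDiffAt

theorem fiberCoord_velocity {φ : ℂ → N} {w : ℂ} (hφ : MDifferentiableAt 𝓘(ℂ, ℂ) 𝓘(ℂ, E) φ w)
    {p : N} (hp : φ w ∈ (chartAt E p).source) :
    fiberCoord p (velocity φ w : TangentBundle 𝓘(ℂ, E) N) = deriv (chartAt E p ∘ φ) w := by
  have hc : MDifferentiableAt 𝓘(ℂ, E) 𝓘(ℂ, E) (chartAt E p) (φ w) :=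
    mdifferentiableAt_atlas (chart_mem_atlas E p) hp
  have h1 : HasMFDerivAt 𝓘(ℂ, ℂ) 𝓘(ℂ, E) (chartAt E p ∘ φ) w
      ((mfderiv 𝓘(ℂ, E) 𝓘(ℂ, E) (chartAt E p) (φ w)).comp (mfderiv 𝓘(ℂ, ℂ) 𝓘(ℂ, E) φ w)) :=
    hc.hasMFDerivAt.comp w hφ.hasMFDerivAt
  let D : ℂ →L[ℂ] E :=
    (mfderiv 𝓘(ℂ, E) 𝓘(ℂ, E) (chartAt E p) (φ w)).comp (mfderiv 𝓘(ℂ, ℂ) 𝓘(ℂ, E) φ w)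
  have h2 : HasFDerivAt (chartAt E p ∘ φ) D w := h1.hasFDerivAt
  rw [fiberCoord_eq_mfderiv (by exact hp)]
  exact h2.hasDerivAt.deriv.symm

theorem contMDiffAt_velocity [CompleteSpace E] {φ : ℂ → N} {U : Set ℂ} (hU : IsOpen U)
    (hφ : MDifferentiableOn 𝓘(ℂ, ℂ) 𝓘(ℂ, E) φ U) {w : ℂ} (hw : w ∈ U) {n : WithTop ℕ∞} :
    ContMDiffAt 𝓘(ℂ, ℂ) 𝓘(ℂ, E).tangent n
      (velocity φ : ℂ → TangentBundle 𝓘(ℂ, E) N) w := by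
  have hsrc : φ w ∈ (chartAt E (φ w)).source := mem_chart_source E (φ w)
  have hc := contDiffAt_chart_comp hU hφ hw hsrc (n := ω)
  have hcont : ContinuousAt φ w := (hφ.continuousOn).continuousAt (hU.mem_nhds hw)
  refine Bundle.contMDiffAt_totalSpace.2 ⟨?_, ?_⟩
  · refine contMDiffAt_iff_target.2 ⟨hcont, ?_⟩
    have : (extChartAt 𝓘(ℂ, E) (φ w) : N → E) = chartAt E (φ w) := by simp [mfld_simps]
    change ContMDiffAt 𝓘(ℂ, ℂ) 𝓘(ℂ, E) n (extChartAt 𝓘(ℂ, E) (φ w) ∘ φ) w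
    rw [this]
    exact (hc.of_le le_top).contMDiffAt
  · have hd : ContDiffAt ℂ n (deriv (chartAt E (φ w) ∘ φ)) w :=
      (AnalyticAt.deriv hc.analyticAt).contDiffAt
    refine hd.contMDiffAt.congr_of_eventuallyEq ?_
    filter_upwards [hU.mem_nhds hw, hcont.preimage_mem_nhds
      ((chartAt E (φ w)).open_source.mem_nhds hsrc)] with u hu hu'
    exact fiberCoord_velocity (hφ.mdifferentiableAt (hU.mem_nhds hu)) hu'

/-- The velocity is smooth for the real structure used in `IsFinslerMetric.smooth`. -/
theorem contMDiffAt_velocity_real [CompleteSpace E] {φ : ℂ → N} {U : Set ℂ} (hU : IsOpen U)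
    (hφ : MDifferentiableOn 𝓘(ℂ, ℂ) 𝓘(ℂ, E) φ U) {w : ℂ} (hw : w ∈ U) {n : WithTop ℕ∞} :
    ContMDiffAt 𝓘(ℝ, ℂ) 𝓘(ℝ, E).tangent n
      (velocity φ : ℂ → TangentBundle 𝓘(ℂ, E) N) w := by
  have h := contMDiffAt_velocity hU hφ hw (n := n)
  exact ⟨h.1, ContDiffWithinAt.restrict_scalars ℝ h.2⟩

namespace IsFinslerMetric

variable {G : TangentBundle 𝓘(ℂ, E) N → ℝ} (hG : IsFinslerMetric G)
include hG

theorem pos {x : TangentBundle 𝓘(ℂ, E) N} (hx : x.snd ≠ 0) : 0 < G x :=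
  lt_of_le_of_ne (hG.nonneg x) fun h => hx ((hG.eq_zero_iff x).1 h.symm)

theorem contDiffAt_comp_velocity [CompleteSpace E] {φ : ℂ → N} {U : Set ℂ} (hU : IsOpen U)
    (hφ : MDifferentiableOn 𝓘(ℂ, ℂ) 𝓘(ℂ, E) φ U) {w : ℂ} (hw : w ∈ U)
    (hne : G (velocity φ w) ≠ 0) : ContDiffAt ℝ 2 (fun u => G (velocity φ u)) w := by
  have hopen : IsOpen {x : TangentBundle 𝓘(ℂ, E) N | x.snd ≠ 0} := by
    have : {x : TangentBundle 𝓘(ℂ, E) N | x.snd ≠ 0} = G ⁻¹' {0}ᶜ := by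
      ext x; simp [hG.eq_zero_iff]
    rw [this]
    exact isOpen_compl_singleton.preimage hG.continuous
  have hmem : (velocity φ w : TangentBundle 𝓘(ℂ, E) N) ∈
      {x : TangentBundle 𝓘(ℂ, E) N | x.snd ≠ 0} := fun h => hne ((hG.eq_zero_iff _).2 h)
  have h1 := hG.smooth.contMDiffAt (hopen.mem_nhds hmem)
  have h2 := h1.comp w (contMDiffAt_velocity_real hU hφ hw)
  exact h2.contDiffAt.of_le (WithTop.coe_le_coe.2 le_top)

theorem continuousOn_comp_velocity [CompleteSpace E] {φ : ℂ → N} {U : Set ℂ} (hU : IsOpen U)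
    (hφ : MDifferentiableOn 𝓘(ℂ, ℂ) 𝓘(ℂ, E) φ U) :
    ContinuousOn (fun u => G (velocity φ u)) U := fun _ hw =>
  (hG.continuous.continuousAt.comp
    (contMDiffAt_velocity hU hφ hw (n := 0)).continuousAt).continuousWithinAt

/-- The curvature hypothesis concerns discs of radius `1` at their centres; translating and
rescaling gives it at every point of a holomorphic curve where the velocity is nonzero. -/
theorem gaussianCurvature_le [CompleteSpace E] {K : ℝ}
    (hcurv : ∀ x : TangentBundle 𝓘(ℂ, E) N, x.snd ≠ 0 →
      holomorphicSectionalCurvature G x ≤ (K : EReal))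
    {φ : ℂ → N} {U : Set ℂ} (hU : IsOpen U)
    (hφ : MDifferentiableOn 𝓘(ℂ, ℂ) 𝓘(ℂ, E) φ U) {w : ℂ} (hw : w ∈ U)
    (hne : G (velocity φ w) ≠ 0) : gaussianCurvature (fun u => G (velocity φ u)) w ≤ K := by
  obtain ⟨ε, hε, hball⟩ := Metric.isOpen_iff.1 hU w hw
  have hmaps : ∀ u ∈ Metric.ball (0 : ℂ) 1, w + ε * u ∈ U := by
    intro u hu
    apply hball
    have : ‖u‖ < 1 := by simpa using hu
    simp only [Metric.mem_ball, dist_self_add_left, norm_mul, Complex.norm_real, Real.norm_eq_abs,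
      abs_of_pos hε]
    nlinarith
  have hv (u : ℂ) (hu : u ∈ Metric.ball (0 : ℂ) 1) :=
    velocity_comp_affine (hφ.mdifferentiableAt (hU.mem_nhds (hmaps u hu)))
  have hg' : (fun u => G (velocity (fun u => φ (w + ε * u)) u)) =ᶠ[𝓝 0]
      fun u => ε ^ 2 * G (velocity φ (w + ε * u)) := by
    filter_upwards [Metric.ball_mem_nhds (0 : ℂ) one_pos] with u hu
    rw [hv u hu]
    exact (hG.smul (velocity φ (w + ε * u)) ε).trans (by simp)
  have hpos : 0 < G (velocity φ w) := lt_of_le_of_ne (hG.nonneg _) hne.symm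
  have hx : (velocity φ w : TangentBundle 𝓘(ℂ, E) N).snd ≠ 0 :=
    fun h => hne ((hG.eq_zero_iff _).2 h)
  have h0 := hv 0 (by simp)
  have hv0 : (velocity (fun u => φ (w + ε * u)) 0 : TangentBundle 𝓘(ℂ, E) N)
      = ⟨φ w, (ε : ℂ) • (velocity φ w : TangentBundle 𝓘(ℂ, E) N).snd⟩ := by
    rw [h0]
    have : w + (ε : ℂ) * 0 = w := by simp
    rw [this]
  rw [← gaussianCurvature_comp_affine (hG.contDiffAt_comp_velocity hU hφ hw hne) hpos hε hg']
  refine EReal.coe_le_coe_iff.1 (le_trans ?_ (hcurv _ hx))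
  unfold holomorphicSectionalCurvature
  exact le_iSup₂_of_le (fun u => φ (w + ε * u)) (mdifferentiableOn_comp_affine hφ hmaps)
    (le_iSup_of_le ⟨ε, by exact_mod_cast hε.ne', hv0⟩ le_rfl)

/-- The Ahlfors–Schwarz lemma for the pull-back of `G` to a disc. -/
theorem neg_mul_le_of_disc [CompleteSpace E] {K : ℝ} (hK : K < 0)
    (hcurv : ∀ x : TangentBundle 𝓘(ℂ, E) N, x.snd ≠ 0 →
      holomorphicSectionalCurvature G x ≤ (K : EReal))
    {f : ℂ → N} {r : ℝ} (hr : 0 < r)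
    (hf : MDifferentiableOn 𝓘(ℂ, ℂ) 𝓘(ℂ, E) f (Metric.ball 0 r)) :
    -K * G (velocity f 0) ≤ 4 * (1 / r) ^ 2 :=
  ahlfors_schwarz (g := fun u => G (velocity f u)) hr hK (fun _ _ => hG.nonneg _)
    (hG.continuousOn_comp_velocity Metric.isOpen_ball hf)
    (fun _ hw hne => hG.contDiffAt_comp_velocity Metric.isOpen_ball hf hw hne)
    (fun _ hw hne => hG.gaussianCurvature_le hcurv Metric.isOpen_ball hf hw hne)

end IsFinslerMetric

end

/-! ### Basic properties of the Kobayashi metric -/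

section

variable {E : Type*} [NormedAddCommGroup E] [NormedSpace ℂ E]
variable {N : Type*} [TopologicalSpace N] [ChartedSpace E N]

theorem kobayashiMetric_nonneg (x : TangentBundle 𝓘(ℂ, E) N) : 0 ≤ kobayashiMetric x := by
  refine Real.sInf_nonneg ?_
  rintro s ⟨r, hr, rfl, -⟩
  positivity

theorem kobayashiMetric_le {x : TangentBundle 𝓘(ℂ, E) N} {f : ℂ → N} {r : ℝ} (hr : 0 < r)
    (hf : MDifferentiableOn 𝓘(ℂ, ℂ) 𝓘(ℂ, E) f (Metric.ball 0 r)) (hx : velocity f 0 = x) :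
    kobayashiMetric x ≤ 1 / r := by
  refine csInf_le ⟨0, ?_⟩ ⟨r, hr, rfl, f, hf, hx⟩
  rintro s ⟨r, hr, rfl, -⟩
  positivity

theorem kobayashiMetric_zero (z : N) :
    kobayashiMetric (⟨z, (0 : E)⟩ : TangentBundle 𝓘(ℂ, E) N) = 0 := by
  refine le_antisymm (le_of_forall_pos_le_add fun ε hε => ?_) (kobayashiMetric_nonneg _)
  -- Constant maps are defined on discs of every radius.
  have h := kobayashiMetric_le (x := (⟨z, (0 : E)⟩ : TangentBundle 𝓘(ℂ, E) N)) (f := fun _ => z)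
    (inv_pos.2 hε) mdifferentiableOn_const ?_
  · simpa using h
  · exact congrArg (fun L : ℂ →L[ℂ] E => (⟨z, L 1⟩ : TangentBundle 𝓘(ℂ, E) N))
      (mfderiv_const (I := 𝓘(ℂ, ℂ)) (I' := 𝓘(ℂ, E)) (c := z) (x := (0 : ℂ)))

end

variable {E : Type*} [NormedAddCommGroup E] [NormedSpace ℂ E]
variable {N : Type*} [TopologicalSpace N] [ChartedSpace E N] [IsManifold 𝓘(ℂ, E) ω N]

/-- In the chart at `p` the disc is affine, with direction `fiberCoord p x`. -/
theorem exists_disc_of_ball_subset {p : N} {x : TangentBundle 𝓘(ℂ, E) N}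
    (hx : x.proj ∈ (chartAt E p).source) {δ r : ℝ}
    (hδ : Metric.ball (chartAt E p x.proj) δ ⊆ (chartAt E p).target) (hr : 0 < r)
    (hrδ : r * ‖fiberCoord p x‖ < δ) :
    ∃ f : ℂ → N, MDifferentiableOn 𝓘(ℂ, ℂ) 𝓘(ℂ, E) f (Metric.ball 0 r) ∧ velocity f 0 = x := by
  set e := fiberCoord p x
  set a := chartAt E p x.proj
  have hmaps : ∀ u ∈ Metric.ball (0 : ℂ) r, a + u • e ∈ (chartAt E p).target := by
    intro u hu
    apply hδ
    have : ‖u‖ < r := by simpa using hu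
    simp only [Metric.mem_ball, dist_self_add_left, norm_smul]
    exact lt_of_le_of_lt (by gcongr) hrδ
  have hf : MDifferentiableOn 𝓘(ℂ, ℂ) 𝓘(ℂ, E) (fun u : ℂ => (chartAt E p).symm (a + u • e))
      (Metric.ball 0 r) :=
    (mdifferentiableOn_atlas_symm (chart_mem_atlas E p)).comp (f := fun u : ℂ => a + u • e)
      (Differentiable.mdifferentiable (by fun_prop)).mdifferentiableOn hmaps
  have h0 : (chartAt E p).symm (a + (0 : ℂ) • e) = x.proj := by
    simp [a, (chartAt E p).left_inv hx]
  refine ⟨_, hf, ?_⟩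
  refine (eq_of_fiberCoord_eq hx h0.symm ?_).symm
  have hball : Metric.ball (0 : ℂ) r ∈ 𝓝 0 := Metric.ball_mem_nhds _ hr
  rw [fiberCoord_velocity (hf.mdifferentiableAt hball) (by rw [h0]; exact hx)]
  have hcongr : (chartAt E p ∘ fun u : ℂ => (chartAt E p).symm (a + u • e))
      =ᶠ[𝓝 0] fun u => a + u • e := by
    filter_upwards [hball] with u hu using (chartAt E p).right_inv (hmaps u hu)
  rw [hcongr.deriv_eq]
  have : HasDerivAt (fun u : ℂ => a + u • e) e 0 := by
    simpa using ((hasDerivAt_id (0 : ℂ)).smul_const e).const_add a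
  exact this.deriv.symm

/-- Every tangent vector is tangent to some holomorphic disc, so the infimum defining
`kobayashiMetric` is over a nonempty set. -/
theorem exists_disc (x : TangentBundle 𝓘(ℂ, E) N) : ∃ r : ℝ, 0 < r ∧ ∃ f : ℂ → N,
    MDifferentiableOn 𝓘(ℂ, ℂ) 𝓘(ℂ, E) f (Metric.ball 0 r) ∧ velocity f 0 = x := by
  obtain ⟨δ, hδ, hball⟩ := Metric.isOpen_iff.1 (chartAt E x.proj).open_target _
    (mem_chart_target E x.proj)
  have hpos : 0 < ‖fiberCoord x.proj x‖ + 1 := by positivity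
  refine ⟨δ / (‖fiberCoord x.proj x‖ + 1), by positivity,
    exists_disc_of_ball_subset (mem_chart_source E x.proj) hball (by positivity) ?_⟩
  rw [div_mul_eq_mul_div, div_lt_iff₀ hpos]
  nlinarith

theorem le_kobayashiMetric {x : TangentBundle 𝓘(ℂ, E) N} {a : ℝ}
    (h : ∀ (f : ℂ → N) (r : ℝ), 0 < r →
      MDifferentiableOn 𝓘(ℂ, ℂ) 𝓘(ℂ, E) f (Metric.ball 0 r) → velocity f 0 = x → a ≤ 1 / r) :
    a ≤ kobayashiMetric x := by
  obtain ⟨r, hr, f, hf, hx⟩ := exists_disc x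
  refine le_csInf ⟨1 / r, r, hr, rfl, f, hf, hx⟩ ?_
  rintro s ⟨r, hr, rfl, f, hf, hx⟩
  exact h f r hr hf hx

theorem kobayashiMetric_smul_le (x : TangentBundle 𝓘(ℂ, E) N) {c : ℂ} (hc : c ≠ 0) :
    kobayashiMetric (⟨x.proj, c • x.snd⟩ : TangentBundle 𝓘(ℂ, E) N)
      ≤ ‖c‖ * kobayashiMetric x := by
  have hc' : 0 < ‖c‖ := norm_pos_iff.2 hc
  rw [← div_le_iff₀' hc']
  refine le_kobayashiMetric fun f r hr hf hx => ?_
  have hmaps : ∀ u ∈ Metric.ball (0 : ℂ) (r / ‖c‖), 0 + c * u ∈ Metric.ball (0 : ℂ) r := by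
    intro u hu
    have : ‖u‖ < r / ‖c‖ := by simpa using hu
    simpa using (lt_div_iff₀' hc').1 this
  have h0 := velocity_comp_affine (a := 0) (b := c) (u := 0) (f := f)
    (hf.mdifferentiableAt (Metric.isOpen_ball.mem_nhds (by simpa using hr)))
  have hz : (0 : ℂ) + c * 0 = 0 := by simp
  rw [hz, hx] at h0
  subst hx
  have h1 := kobayashiMetric_le (div_pos hr hc') (mdifferentiableOn_comp_affine hf hmaps) h0
  rw [div_le_iff₀' hc']
  refine h1.trans_eq ?_
  field_simp

theorem kobayashiMetric_smul (x : TangentBundle 𝓘(ℂ, E) N) (c : ℂ) :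
    kobayashiMetric (⟨x.proj, c • x.snd⟩ : TangentBundle 𝓘(ℂ, E) N)
      = ‖c‖ * kobayashiMetric x := by
  rcases eq_or_ne c 0 with rfl | hc
  · rw [norm_zero, zero_mul]
    have h : (0 : ℂ) • x.snd = 0 := zero_smul ℂ x.snd
    rw [h]
    exact kobayashiMetric_zero x.proj
  refine le_antisymm (kobayashiMetric_smul_le x hc) ?_
  have h := kobayashiMetric_smul_le (⟨x.proj, c • x.snd⟩ : TangentBundle 𝓘(ℂ, E) N)
    (inv_ne_zero hc)
  have h2 : c⁻¹ • c • x.snd = x.snd := inv_smul_smul₀ hc x.snd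
  rw [h2, norm_inv] at h
  rwa [le_inv_mul_iff₀ (norm_pos_iff.2 hc)] at h

/-- A local upper bound for the Kobayashi metric.  The summand `1` provides a positive
denominator for the radius of the disc when the vector is zero. -/
theorem exists_kobayashiMetric_le (p : N) : ∃ ρ > 0, Metric.ball (chartAt E p p) ρ ⊆
    (chartAt E p).target ∧ ∃ C : ℝ, ∀ x : TangentBundle 𝓘(ℂ, E) N,
      x.proj ∈ (chartAt E p).source → chartAt E p x.proj ∈ Metric.ball (chartAt E p p) ρ →
      kobayashiMetric x ≤ C * (‖fiberCoord p x‖ + 1) := by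
  obtain ⟨δ, hδ, hball⟩ := Metric.isOpen_iff.1 (chartAt E p).open_target _
    (mem_chart_target E p)
  refine ⟨δ / 2, by positivity, (Metric.ball_subset_ball (by linarith)).trans hball, 2 / δ,
    fun x hx hxρ => ?_⟩
  have hpos : 0 < ‖fiberCoord p x‖ + 1 := by positivity
  -- The chart contains the ball of radius `δ`, so the centre may move by `δ / 2`.
  have hsub : Metric.ball (chartAt E p x.proj) (δ / 2) ⊆ (chartAt E p).target := by
    refine (Metric.ball_subset_ball' ?_).trans hball
    have := Metric.mem_ball.1 hxρ
    linarith
  have hr : 0 < δ / 2 / (‖fiberCoord p x‖ + 1) := by positivity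
  obtain ⟨f, hf, hv⟩ := exists_disc_of_ball_subset hx hsub hr (by
    rw [div_mul_eq_mul_div, div_lt_iff₀ hpos]
    nlinarith)
  refine (kobayashiMetric_le hr hf hv).trans_eq ?_
  field_simp

/-! ### The Kobayashi distance as a length distance -/

variable (E) in
/-- The extended norm `V ↦ 2 k(V)` on the tangent spaces of the underlying real manifold.  It
need not satisfy the triangle inequality. -/
@[reducible] def kobayashiENorm (z : N) : ENorm (TangentSpace 𝓘(ℝ, E) z) :=
  ⟨fun v => ENNReal.ofReal (2 * kobayashiMetric (⟨z, (v : E)⟩ : TangentBundle 𝓘(ℂ, E) N))⟩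

attribute [local instance] kobayashiENorm

theorem kobayashiENorm_enormSMulClass (z : N) :
    ENormSMulClass ℝ (TangentSpace 𝓘(ℝ, E) z) := by
  refine ⟨fun c v => ?_⟩
  have h := kobayashiMetric_smul (⟨z, (v : E)⟩ : TangentBundle 𝓘(ℂ, E) N) (c : ℂ)
  change ENNReal.ofReal (2 * kobayashiMetric
      (⟨z, (c : ℂ) • (show E from v)⟩ : TangentBundle 𝓘(ℂ, E) N))
    = ‖c‖ₑ * ENNReal.ofReal (2 * kobayashiMetric (⟨z, (v : E)⟩ : TangentBundle 𝓘(ℂ, E) N))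
  rw [← ofReal_norm, ← ENNReal.ofReal_mul (norm_nonneg c)]
  congr 1
  rw [Complex.norm_real] at h
  calc _ = 2 * (‖c‖ * _) := congrArg (2 * ·) h
    _ = _ := by ring

attribute [local instance] kobayashiENorm_enormSMulClass

omit [IsManifold 𝓘(ℂ, E) ω N] in
theorem kobayashiLength_eq_pathELength (c : ℝ → N) :
    kobayashiLength E c = Manifold.pathELength 𝓘(ℝ, E) c 0 1 := by
  rw [Manifold.pathELength_eq_lintegral_mfderivWithin_Icc]
  rfl

theorem kobayashiDist_eq_riemannianEDist (p q : N) :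
    kobayashiDist E p q = Manifold.riemannianEDist 𝓘(ℝ, E) p q := by
  refine le_antisymm (le_of_forall_gt fun r hr => ?_) ?_
  · obtain ⟨c, h0, h1, hc, hlt⟩ := Manifold.exists_lt_of_riemannianEDist_lt hr
    rw [← kobayashiLength_eq_pathELength] at hlt
    refine lt_of_le_of_lt ?_ hlt
    unfold kobayashiDist
    exact iInf₂_le_of_le c hc (iInf₂_le_of_le h0 h1 le_rfl)
  · unfold kobayashiDist
    refine le_iInf₂ fun c hc => le_iInf₂ fun h0 h1 => ?_
    rw [kobayashiLength_eq_pathELength]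
    exact Manifold.riemannianEDist_le_pathELength hc h0 h1 zero_le_one

theorem kobayashiDist_self (p : N) : kobayashiDist E p p = 0 := by
  rw [kobayashiDist_eq_riemannianEDist, Manifold.riemannianEDist_self]

theorem kobayashiDist_comm (p q : N) : kobayashiDist E p q = kobayashiDist E q p := by
  rw [kobayashiDist_eq_riemannianEDist, kobayashiDist_eq_riemannianEDist,
    Manifold.riemannianEDist_comm]

theorem kobayashiDist_triangle (p q r : N) :
    kobayashiDist E p r ≤ kobayashiDist E p q + kobayashiDist E q r := by
  simp only [kobayashiDist_eq_riemannianEDist]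
  exact Manifold.riemannianEDist_triangle

/-! ### Estimates of the Kobayashi distance -/

theorem fiberCoord_curveVelocity {c : ℝ → N} {t : ℝ} (ht : t ∈ Icc (0 : ℝ) 1)
    (hc : MDifferentiableWithinAt 𝓘(ℝ, ℝ) 𝓘(ℝ, E) c (Icc 0 1) t) {p : N}
    (hp : c t ∈ (chartAt E p).source) :
    fiberCoord p (curveVelocity c t : TangentBundle 𝓘(ℂ, E) N)
      = derivWithin (chartAt E p ∘ c) (Icc 0 1) t := by
  have hchart : MDifferentiableAt 𝓘(ℂ, E) 𝓘(ℂ, E) (chartAt E p) (c t) :=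
    mdifferentiableAt_atlas (chart_mem_atlas E p) hp
  have h1 := (hasMFDerivAt_restrictScalars hchart.hasMFDerivAt).comp_hasMFDerivWithinAt t
    hc.hasMFDerivWithinAt
  let A : E →L[ℂ] E := mfderiv 𝓘(ℂ, E) 𝓘(ℂ, E) (chartAt E p) (c t)
  let B : ℝ →L[ℝ] E := mfderivWithin 𝓘(ℝ, ℝ) 𝓘(ℝ, E) c (Icc 0 1) t
  have h2 : HasFDerivWithinAt (chartAt E p ∘ c) ((A.restrictScalars ℝ).comp B) (Icc 0 1) t :=
    h1.hasFDerivWithinAt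
  rw [fiberCoord_eq_mfderiv (by exact hp)]
  exact (h2.hasDerivWithinAt.derivWithin (uniqueDiffOn_Icc zero_lt_one t ht)).symm

/-- Nearby points are joined by a segment in the chart, of finite length since the Kobayashi
metric is bounded along it. -/
theorem eventually_kobayashiDist_lt_top (p : N) : ∀ᶠ q in 𝓝 p, kobayashiDist E p q < ⊤ := by
  have := isManifold_restrictScalars (E := E) (N := N)
  obtain ⟨ρ, hρ, hsub, C, hC⟩ := exists_kobayashiMetric_le (E := E) p
  have hnhds : chartAt E p ⁻¹' Metric.ball (chartAt E p p) ρ ∈ 𝓝 p :=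
    ((chartAt E p).continuousAt (mem_chart_source E p)).preimage_mem_nhds
      (Metric.ball_mem_nhds _ hρ)
  filter_upwards [hnhds, chart_source_mem_nhds E p] with q hq hqs
  set a := chartAt E p p
  set b := chartAt E p q
  let ℓ : ℝ → E := fun t => a + t • (b - a)
  have hℓ : ∀ t ∈ Icc (0 : ℝ) 1, ℓ t ∈ Metric.ball a ρ := fun t ht => by
    have := (convex_ball a ρ).add_smul_sub_mem (Metric.mem_ball_self hρ) hq ht
    exact this
  have hc : ContMDiffOn 𝓘(ℝ, ℝ) 𝓘(ℝ, E) 1 (fun t => (chartAt E p).symm (ℓ t)) (Icc 0 1) := by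
    refine (contMDiffOn_chart_symm (I := 𝓘(ℝ, E)) (x := p)).comp (f := ℓ) ?_
      fun t ht => hsub (hℓ t ht)
    exact ContDiff.contMDiff (by fun_prop) |>.contMDiffOn
  have h0 : (chartAt E p).symm (ℓ 0) = p := by
    simp [ℓ, a, (chartAt E p).left_inv (mem_chart_source E p)]
  have h1 : (chartAt E p).symm (ℓ 1) = q := by
    simp [ℓ, b, (chartAt E p).left_inv hqs]
  have hle : kobayashiDist E p q ≤ kobayashiLength E fun t => (chartAt E p).symm (ℓ t) :=
    iInf₂_le_of_le _ hc (iInf₂_le_of_le h0 h1 le_rfl)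
  refine hle.trans_lt ?_
  have hbound : kobayashiLength E (fun t => (chartAt E p).symm (ℓ t))
      ≤ ∫⁻ _ in Icc (0 : ℝ) 1, ENNReal.ofReal (2 * (C * (‖b - a‖ + 1))) := by
    refine MeasureTheory.setLIntegral_mono' measurableSet_Icc fun t ht => ?_
    have htarget := hsub (hℓ t ht)
    have hsrc := (chartAt E p).map_target htarget
    have hcoord : fiberCoord p
        (curveVelocity (fun t => (chartAt E p).symm (ℓ t)) t : TangentBundle 𝓘(ℂ, E) N)
          = b - a := by
      rw [fiberCoord_curveVelocity ht (hc.mdifferentiableOn one_ne_zero t ht) hsrc]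
      have : HasDerivWithinAt ℓ (b - a) (Icc 0 1) t := by
        have hd := ((hasDerivAt_id t).smul_const (b - a)).const_add a
        rw [one_smul] at hd
        exact hd.hasDerivWithinAt
      refine (this.congr_of_mem (fun s hs => ?_) ht).derivWithin
        (uniqueDiffOn_Icc zero_lt_one t ht)
      exact (chartAt E p).right_inv (hsub (hℓ s hs))
    rw [← hcoord]
    gcongr
    refine hC _ hsrc ?_
    change chartAt E p ((chartAt E p).symm (ℓ t)) ∈ _
    rw [(chartAt E p).right_inv htarget]
    exact hℓ t ht
  refine hbound.trans_lt ?_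
  rw [MeasureTheory.setLIntegral_const, Real.volume_Icc]
  exact ENNReal.mul_lt_top ENNReal.ofReal_lt_top ENNReal.ofReal_lt_top

theorem kobayashiDist_ne_top_of_mem_connectedComponent {p q : N}
    (hq : q ∈ connectedComponent p) : kobayashiDist E p q ≠ ⊤ := by
  have hclopen : IsClopen {q : N | kobayashiDist E p q < ⊤} := by
    refine ⟨⟨isOpen_iff_mem_nhds.2 fun q hq => ?_⟩, isOpen_iff_mem_nhds.2 fun q hq => ?_⟩
    · filter_upwards [eventually_kobayashiDist_lt_top (E := E) q] with q' hq' h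
      refine hq ((kobayashiDist_triangle p q' q).trans_lt (ENNReal.add_lt_top.2 ⟨h, ?_⟩))
      rwa [kobayashiDist_comm]
    · filter_upwards [eventually_kobayashiDist_lt_top (E := E) q] with q' hq'
      exact (kobayashiDist_triangle p q q').trans_lt (ENNReal.add_lt_top.2 ⟨hq, hq'⟩)
  have hp : p ∈ {q : N | kobayashiDist E p q < ⊤} := by
    simp [kobayashiDist_self]
  exact (hclopen.connectedComponent_subset hp hq).ne

/-- If the Kobayashi metric dominates a multiple of the norm in the chart at `p`, every curve from
`p` to another point has length bounded below, because it must leave a closed ball of the chart.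
The space is Hausdorff in order that the image of this ball is closed in `N`, so that the curve
leaves it through its boundary. -/
theorem kobayashiDist_pos [T2Space N] [ProperSpace E] {p q : N} (hpq : p ≠ q) {m ρ₀ : ℝ}
    (hm : 0 < m) (hρ₀ : 0 < ρ₀)
    (hlow : ∀ x : TangentBundle 𝓘(ℂ, E) N, x.proj ∈ (chartAt E p).source →
      chartAt E p x.proj ∈ Metric.closedBall (chartAt E p p) ρ₀ →
      m * ‖fiberCoord p x‖ ≤ 2 * kobayashiMetric x) :
    0 < kobayashiDist E p q := by
  have := isManifold_restrictScalars (E := E) (N := N)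
  set φ := chartAt E p
  have hpsrc : p ∈ φ.source := mem_chart_source E p
  have hptgt : φ p ∈ φ.target := mem_chart_target E p
  have hN : φ.target ∩ φ.symm ⁻¹' {q}ᶜ ∈ 𝓝 (φ p) := by
    refine inter_mem (φ.open_target.mem_nhds hptgt)
      ((φ.continuousAt_symm hptgt).preimage_mem_nhds ?_)
    rw [φ.left_inv hpsrc]
    exact isOpen_compl_singleton.mem_nhds hpq
  -- Shrink the ball so that it lies in the chart and avoids `q`.
  obtain ⟨ρ₁, hρ₁, hball⟩ := Metric.nhds_basis_closedBall.mem_iff.1 hN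
  obtain ⟨ρ, hρ, hρ0, hρ1⟩ : ∃ ρ > 0, ρ ≤ ρ₀ ∧ ρ ≤ ρ₁ :=
    ⟨min ρ₀ ρ₁, lt_min hρ₀ hρ₁, min_le_left _ _, min_le_right _ _⟩
  have hsub : Metric.closedBall (φ p) ρ ⊆ φ.target ∩ φ.symm ⁻¹' {q}ᶜ :=
    (Metric.closedBall_subset_closedBall hρ1).trans hball
  have hK : IsClosed (φ.symm '' Metric.closedBall (φ p) ρ) :=
    ((isCompact_closedBall _ _).image_of_continuousOn
      (φ.continuousOn_symm.mono (hsub.trans inter_subset_left))).isClosed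
  have hKmem : ∀ z ∈ φ.symm '' Metric.closedBall (φ p) ρ,
      z ∈ φ.source ∧ φ z ∈ Metric.closedBall (φ p) ρ ∧ z ≠ q := by
    rintro _ ⟨u, hu, rfl⟩
    refine ⟨φ.map_target (hsub hu).1, ?_, (hsub hu).2⟩
    rwa [φ.right_inv (hsub hu).1]
  have hVopen : IsOpen (φ.source ∩ φ ⁻¹' Metric.ball (φ p) ρ) :=
    φ.isOpen_inter_preimage Metric.isOpen_ball
  have hVK : φ.source ∩ φ ⁻¹' Metric.ball (φ p) ρ ⊆ φ.symm '' Metric.closedBall (φ p) ρ :=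
    fun z hz => ⟨φ z, Metric.ball_subset_closedBall hz.2, φ.left_inv hz.1⟩
  suffices h : ENNReal.ofReal (m * ρ) ≤ kobayashiDist E p q from
    lt_of_lt_of_le (ENNReal.ofReal_pos.2 (by positivity)) h
  unfold kobayashiDist
  refine le_iInf₂ fun c hc => le_iInf₂ fun h0 h1 => ?_
  have hcc : ContinuousOn c (Icc 0 1) := hc.continuousOn
  -- `t₁` is the first time at which the curve is outside the open ball.
  obtain ⟨t₁, ⟨ht₁, ht₁V⟩, hleast⟩ : ∃ t₁, IsLeast
      (Icc (0 : ℝ) 1 ∩ c ⁻¹' (φ.source ∩ φ ⁻¹' Metric.ball (φ p) ρ)ᶜ) t₁ := by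
    refine IsCompact.exists_isLeast ?_ ⟨1, by simp, ?_⟩
    · exact isCompact_Icc.of_isClosed_subset
        (hcc.preimage_isClosed_of_isClosed isClosed_Icc hVopen.isClosed_compl) inter_subset_left
    · intro h
      exact (hKmem _ (hVK h)).2.2 h1
  have hbefore : ∀ t ∈ Ico 0 t₁, c t ∈ φ.source ∩ φ ⁻¹' Metric.ball (φ p) ρ := by
    intro t ht
    by_contra h
    exact (hleast ⟨⟨ht.1, ht.2.le.trans ht₁.2⟩, h⟩).not_gt ht.2
  have ht₁pos : 0 < t₁ := by
    refine lt_of_le_of_ne ht₁.1 ?_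
    rintro rfl
    exact ht₁V (by rw [h0]; exact ⟨hpsrc, Metric.mem_ball_self hρ⟩)
  have hsubI : Icc 0 t₁ ⊆ Icc (0 : ℝ) 1 := Icc_subset_Icc_right ht₁.2
  have hend : c t₁ ∈ φ.symm '' Metric.closedBall (φ p) ρ := by
    have htend : Tendsto c (𝓝[<] t₁) (𝓝 (c t₁)) :=
      ((hcc t₁ ht₁).mono_of_mem_nhdsWithin
        (mem_of_superset (Ico_mem_nhdsLT ht₁pos) (Ico_subset_Icc_self.trans hsubI)))
    refine hK.mem_of_tendsto htend ?_
    filter_upwards [Ico_mem_nhdsLT ht₁pos] with t ht using hVK (hbefore t ht)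
  have hin : ∀ t ∈ Icc 0 t₁, c t ∈ φ.symm '' Metric.closedBall (φ p) ρ := by
    intro t ht
    rcases ht.2.eq_or_lt with rfl | h
    · exact hend
    · exact hVK (hbefore t ⟨ht.1, h⟩)
  have hfar : ρ ≤ ‖φ (c t₁) - φ (c 0)‖ := by
    by_contra! h
    rw [h0, ← dist_eq_norm] at h
    exact ht₁V ⟨(hKmem _ hend).1, h⟩
  have hsmooth : ContDiffOn ℝ 1 (φ ∘ c) (Icc 0 t₁) := by
    rw [← contMDiffOn_iff_contDiffOn]
    exact (contMDiffOn_chart (I := 𝓘(ℝ, E)) (x := p)).comp (hc.mono hsubI)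
      fun t ht => (hKmem _ (hin t ht)).1
  calc ENNReal.ofReal (m * ρ)
      = ENNReal.ofReal m * ENNReal.ofReal ρ := ENNReal.ofReal_mul hm.le
    _ ≤ ENNReal.ofReal m * ‖(φ ∘ c) t₁ - (φ ∘ c) 0‖ₑ := by
        gcongr
        rw [← ofReal_norm]
        exact ENNReal.ofReal_le_ofReal hfar
    _ ≤ ENNReal.ofReal m * ∫⁻ t in Icc 0 t₁, ‖deriv (φ ∘ c) t‖ₑ := by
        gcongr
        exact enorm_sub_le_lintegral_deriv_of_contDiffOn_Icc hsmooth ht₁pos.le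
    _ = ∫⁻ t in Ioo 0 t₁, ENNReal.ofReal m * ‖deriv (φ ∘ c) t‖ₑ := by
        -- On the open interval `deriv` agrees with the derivative within `[0, 1]` in `curveVelocity`.
        rw [MeasureTheory.lintegral_const_mul' _ _ ENNReal.ofReal_ne_top,
          MeasureTheory.restrict_Ioo_eq_restrict_Icc]
    _ ≤ ∫⁻ t in Ioo 0 t₁, ENNReal.ofReal
          (2 * kobayashiMetric (curveVelocity c t : TangentBundle 𝓘(ℂ, E) N)) := by
        refine MeasureTheory.setLIntegral_mono' measurableSet_Ioo fun t ht => ?_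
        have ht' : t ∈ Icc (0 : ℝ) 1 := hsubI (Ioo_subset_Icc_self ht)
        have htK := hKmem _ (hin t (Ioo_subset_Icc_self ht))
        rw [← ofReal_norm, ← ENNReal.ofReal_mul hm.le,
          ← derivWithin_of_mem_nhds (Icc_mem_nhds ht.1 (ht.2.trans_le ht₁.2)),
          ← fiberCoord_curveVelocity ht' (hc.mdifferentiableOn one_ne_zero t ht') htK.1]
        exact ENNReal.ofReal_le_ofReal
          (hlow _ htK.1 (Metric.closedBall_subset_closedBall hρ0 htK.2.1))
    _ ≤ kobayashiLength E c :=
        MeasureTheory.lintegral_mono_set (Ioo_subset_Icc_self.trans hsubI)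

/-- By homogeneity, it is enough to bound `G` from below on unit vectors over a closed ball, where
`G` is positive and continuous on a compact set. -/
theorem IsFinslerMetric.exists_mul_sq_le [ProperSpace E] {G : TangentBundle 𝓘(ℂ, E) N → ℝ}
    (hG : IsFinslerMetric G) (p : N) : ∃ ρ > 0, ∃ m > 0, ∀ x : TangentBundle 𝓘(ℂ, E) N,
      x.proj ∈ (chartAt E p).source →
      chartAt E p x.proj ∈ Metric.closedBall (chartAt E p p) ρ →
      m * ‖fiberCoord p x‖ ^ 2 ≤ G x := by
  set φ := chartAt E p
  set e := trivializationAt E (TangentSpace 𝓘(ℂ, E)) p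
  obtain ⟨ρ, hρ, hsub⟩ := Metric.nhds_basis_closedBall.mem_iff.1
    (φ.open_target.mem_nhds (mem_chart_target E p))
  have hmem : ∀ y ∈ Metric.closedBall (φ p) ρ ×ˢ Metric.sphere (0 : E) 1,
      (φ.symm y.1, y.2) ∈ e.target := fun y hy =>
    e.mem_target.2 (φ.map_target (hsub hy.1))
  have hcont : ContinuousOn
      (fun y : E × E => G (e.toOpenPartialHomeomorph.symm (φ.symm y.1, y.2)))
      (Metric.closedBall (φ p) ρ ×ˢ Metric.sphere (0 : E) 1) := by
    refine hG.continuous.comp_continuousOn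
      (e.toOpenPartialHomeomorph.continuousOn_symm.comp ?_ hmem)
    refine ContinuousOn.prodMk ?_ continuousOn_snd
    exact φ.continuousOn_symm.comp continuousOn_fst fun y hy => hsub hy.1
  have hpos : ∀ y ∈ Metric.closedBall (φ p) ρ ×ˢ Metric.sphere (0 : E) 1,
      0 < G (e.toOpenPartialHomeomorph.symm (φ.symm y.1, y.2)) := by
    intro y hy
    refine hG.pos fun hzero => ?_
    have hproj : (e.toOpenPartialHomeomorph.symm (φ.symm y.1, y.2)).proj ∈ φ.source := by
      rw [e.proj_symm_apply (hmem y hy)]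
      exact φ.map_target (hsub hy.1)
    have h1 : fiberCoord p (e.toOpenPartialHomeomorph.symm (φ.symm y.1, y.2)) = y.2 :=
      congrArg Prod.snd (e.apply_symm_apply (hmem y hy))
    rw [fiberCoord_eq_mfderiv hproj, hzero] at h1
    have h2 : y.2 = 0 := h1.symm.trans (map_zero _)
    have h3 : ‖y.2‖ = 1 := by simpa using hy.2
    rw [h2, norm_zero] at h3
    exact zero_ne_one h3
  obtain ⟨m, hm, hle⟩ := ((isCompact_closedBall (φ p) ρ).prod
    (isCompact_sphere (0 : E) 1)).exists_forall_le' hcont hpos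
  refine ⟨ρ, hρ, m, hm, fun x hx hxρ => ?_⟩
  rcases eq_or_ne (fiberCoord p x) 0 with h0 | h0
  · rw [h0]
    simpa using hG.nonneg x
  have hn : 0 < ‖fiberCoord p x‖ := norm_pos_iff.2 h0
  let c : ℂ := ((‖fiberCoord p x‖⁻¹ : ℝ) : ℂ)
  have hc : ‖c‖ = ‖fiberCoord p x‖⁻¹ := by simp [c]
  have hcoord := fiberCoord_smul hx c
  have hunit : ‖c • fiberCoord p x‖ = 1 := by
    rw [norm_smul, hc, inv_mul_cancel₀ hn.ne']
  have h1 := hle (φ x.proj, c • fiberCoord p x) ⟨hxρ, by simpa using hunit⟩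
  have h2 : e.toOpenPartialHomeomorph.symm (φ.symm (φ x.proj), c • fiberCoord p x)
      = ⟨x.proj, c • x.snd⟩ := by
    rw [φ.left_inv hx, ← hcoord]
    exact e.symm_apply_mk_proj (x := ⟨x.proj, c • x.snd⟩) (e.mem_source.2 hx)
  simp only [h2] at h1
  rw [hG.smul, hc] at h1
  calc m * ‖fiberCoord p x‖ ^ 2
      ≤ (‖fiberCoord p x‖⁻¹ ^ 2 * G x) * ‖fiberCoord p x‖ ^ 2 := by gcongr
    _ = G x := by field_simp

/-! ### Hyperbolicity -/

theorem IsFinslerMetric.neg_mul_le_kobayashiMetric_sq [CompleteSpace E]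
    {G : TangentBundle 𝓘(ℂ, E) N → ℝ} (hG : IsFinslerMetric G) {K : ℝ} (hK : K < 0)
    (hcurv : ∀ x : TangentBundle 𝓘(ℂ, E) N, x.snd ≠ 0 →
      holomorphicSectionalCurvature G x ≤ (K : EReal)) (x : TangentBundle 𝓘(ℂ, E) N) :
    -K * G x ≤ 4 * kobayashiMetric x ^ 2 := by
  have h : √(-K * G x) / 2 ≤ kobayashiMetric x := by
    refine le_kobayashiMetric fun f r hr hf hx => ?_
    have h1 := hG.neg_mul_le_of_disc hK hcurv hr hf
    rw [hx] at h1
    have h2 : √(-K * G x) ≤ 2 * (1 / r) :=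
      Real.sqrt_le_iff.2 ⟨by positivity, by linarith [mul_pow 2 (1 / r) 2]⟩
    linarith
  have h3 : √(-K * G x) ≤ 2 * kobayashiMetric x := by linarith
  linarith [(Real.sqrt_le_iff.1 h3).2, mul_pow 2 (kobayashiMetric x) 2]

/-- A manifold whose Kobayashi metric dominates a positive multiple of a Finsler metric, in the sense of
`hle`, is hyperbolic. -/
theorem IsFinslerMetric.isKobayashiHyperbolic [T2Space N] [ProperSpace E]
    {G : TangentBundle 𝓘(ℂ, E) N → ℝ} (hG : IsFinslerMetric G) {a : ℝ} (ha : 0 < a)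
    (hle : ∀ x : TangentBundle 𝓘(ℂ, E) N, a * G x ≤ 4 * kobayashiMetric x ^ 2) :
    IsKobayashiHyperbolic E N := by
  refine ⟨fun p q => ⟨fun h => ?_, fun h => h ▸ kobayashiDist_self p⟩, kobayashiDist_comm,
    kobayashiDist_triangle, fun p q hq => kobayashiDist_ne_top_of_mem_connectedComponent hq⟩
  by_contra hpq
  obtain ⟨ρ, hρ, m, hm, hlow⟩ := hG.exists_mul_sq_le p
  have ham : 0 < a * m := mul_pos ha hm
  refine (kobayashiDist_pos hpq (Real.sqrt_pos.2 ham) hρ fun x hx hxρ => ?_).ne' h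
  refine le_of_sq_le_sq ?_ (mul_nonneg zero_le_two (kobayashiMetric_nonneg x))
  rw [mul_pow, Real.sq_sqrt ham.le, mul_pow]
  calc a * m * ‖fiberCoord p x‖ ^ 2 = a * (m * ‖fiberCoord p x‖ ^ 2) := by ring
    _ ≤ a * G x := mul_le_mul_of_nonneg_left (hlow x hx hxρ) ha.le
    _ ≤ 4 * kobayashiMetric x ^ 2 := hle x
    _ = _ := by norm_num

end

end ComplexFinsler

theorem mainTheorem6
    {E : Type*} [NormedAddCommGroup E] [NormedSpace ℂ E] [FiniteDimensional ℂ E]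
    {N : Type*} [TopologicalSpace N] [T2Space N] [ChartedSpace E N] [IsManifold 𝓘(ℂ, E) ω N]
    (G₁ : TangentBundle 𝓘(ℂ, E) N → ℝ) (hG₁ : ComplexFinsler.IsFinslerMetric G₁)
    (K₂ : ℝ) (hK₂ : K₂ < 0)
    (hcurv : ∀ x : TangentBundle 𝓘(ℂ, E) N, x.snd ≠ 0 →
      ComplexFinsler.holomorphicSectionalCurvature G₁ x ≤ (K₂ : EReal)) :
    (∀ x : TangentBundle 𝓘(ℂ, E) N,
      4 * ComplexFinsler.kobayashiMetric x ^ 2 ≥ -K₂ * G₁ x) ∧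
    ComplexFinsler.IsKobayashiHyperbolic E N := by
  have : CompleteSpace E := FiniteDimensional.complete ℂ E
  have : ProperSpace E := FiniteDimensional.proper ℂ E
  have hle := hG₁.neg_mul_le_kobayashiMetric_sq hK₂ hcurv
  exact ⟨hle, hG₁.isKobayashiHyperbolic (neg_pos.2 hK₂) hle⟩
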